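/- All rings are associative with $1$. Let $R\subseteq A$ be rings. $A$ is a \emph{quasi-commutative skew PBW extension} of $R$ in $x_1,\ldots,x_n\in A$ if (i) $A$ is a free left $R$-module with basis the monomials $x_1^{t_1}\cdots x_n^{t_n}$, $(t_1,\ldots,t_n)\in\mathbb{N}^n$; (ii) for all $i$ and all $r\in R\setminus\{0\}$ there is $c_{i,r}\in R\setminus\{0\}$ with $x_ir=c_{i,r}x_i$; (iii) for all $i,j$ there is $c_{ij}\in R\setminus\{0\}$ with $x_ix_j=c_{ij}x_jx_i$. Then $x_ir=\sigma_i(r)x_i$ $(r\in R)$ for a unique ring endomorphism $\sigma_i$ of $R$. Let $R^*$ be the group of units of $R$ and let $N$ be the subgroup of $R^*$ generated by the derived subgroup $[R^*,R^*]$ and all $z^{-1}\sigma_i(z)$ with $z\in R^*$, $1\le i\le n$. The extension is \emph{general} if every $c_{ij}$ is invertible in $R$ and the images of the $c_{ij}$, $1\le i<j\le n$, in the abelian group $R^*/N$ are multiplicatively independent, that is, $\prod_{i<j}c_{ij}^{k_{ij}}\in N$ with $k_{ij}\in\mathbb{Z}$ only if all $k_{ij}=0$. \textbf{Theorem.} Let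 $R$ be a left Ore domain, $S=R\setminus\{0\}$, and let $A$ be a quasi-commutative skew PBW extension of $R$ in $x_1,\ldots,x_n$. Suppose that the left Ore localization $S^{-1}A$ is a general quasi-commutative skew PBW extension of the division ring $S^{-1}R$ in $\frac{x_1}{1},\ldots,\frac{x_n}{1}$. Let $\lambda:A\to A$ be a ring endomorphism with $\lambda(r)=r$ for all $r\in R$, and suppose that $\lambda(x_i),\lambda(x_j),\lambda(x_t)\neq 0$ for three distinct indices $i,j,t$. Then there exist $\lambda_1,\ldots,\lambda_n\in R$ such that $\lambda(x_w)=\lambda_wx_w$ for every $1\le w\le n$. -/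

import Mathlib

open scoped nonZeroDivisors

noncomputable section

/-- The standard monomial `x_1 ^ t_1 * ⋯ * x_n ^ t_n` (the factors in this order). -/
def stdMonomial {A : Type*} [Ring A] {n : ℕ} (x : Fin n → A) (t : Fin n → ℕ) : A :=
  (List.ofFn fun i => x i ^ t i).prod

/-- `A` is a quasi-commutative skew PBW extension of `R` in the variables `x_1, …, x_n`.
The inclusion `R ⊆ A` is the injective ring homomorphism `ι`, and `A` is a left `R`-module
through `ι`. -/
structure IsQuasiCommSkewPBW {R A : Type*} [Ring R] [Ring A] {n : ℕ}
    (ι : R →+* A) (x : Fin n → A) : Prop where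
  /-- `R ⊆ A`. -/
  injective : Function.Injective ι
  /-- `A` is a free left `R`-module with basis the standard monomials: every element is
  `∑ a_t x^t` for exactly one finitely supported family `(a_t)` in `R`. -/
  basis : Function.Bijective
    (fun f : (Fin n → ℕ) →₀ R => f.sum fun t a => ι a * stdMonomial x t)
  /-- `x_i r = c_{i,r} x_i` with `c_{i,r} ≠ 0`, for `r ≠ 0`. -/
  var_mul : ∀ (i : Fin n) (r : R), r ≠ 0 → ∃ c : R, c ≠ 0 ∧ x i * ι r = ι c * x i
  /-- `x_i x_j = c_{i,j} x_j x_i` with `c_{i,j} ≠ 0`. -/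
  var_comm : ∀ i j : Fin n, ∃ c : R, c ≠ 0 ∧ x i * x j = ι c * (x j * x i)

namespace IsQuasiCommSkewPBW

theorem prod_ofFn_eq {A : Type*} [Ring A] : ∀ {n : ℕ} (f : Fin n → A) (i : Fin n),
    (∀ k, k ≠ i → f k = 1) → (List.ofFn f).prod = f i
  | 0, _, i, _ => i.elim0
  | n + 1, f, i, h => by
    rw [List.ofFn_succ, List.prod_cons]
    induction i using Fin.cases with
    | zero =>
      rw [List.prod_eq_one, mul_one]
      intro a ha
      obtain ⟨k, rfl⟩ := (List.mem_ofFn' _ _).1 ha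
      exact h _ (Fin.succ_ne_zero k)
    | succ i =>
      rw [h 0 (Fin.succ_ne_zero i).symm, one_mul]
      exact prod_ofFn_eq (fun k => f k.succ) i
        fun k hk => h _ fun e => hk (Fin.succ_injective _ e)

theorem stdMonomial_single {A : Type*} [Ring A] {n : ℕ} (x : Fin n → A) (i : Fin n) :
    stdMonomial x (Pi.single i 1) = x i := by
  rw [stdMonomial, prod_ofFn_eq _ i]
  · simp
  · intro k hk
    simp [Pi.single_eq_of_ne hk]

variable {R A : Type*} [Ring R] [Ring A] {n : ℕ} {ι : R →+* A} {x : Fin n → A}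

theorem cancel_var (h : IsQuasiCommSkewPBW ι x) (i : Fin n) {a b : R}
    (e : ι a * x i = ι b * x i) : a = b := by
  have key : Finsupp.single (Pi.single i 1 : Fin n → ℕ) a = Finsupp.single (Pi.single i 1) b := by
    apply h.basis.1
    simp only
    rw [Finsupp.sum_single_index (by simp), Finsupp.sum_single_index (by simp),
      stdMonomial_single, e]
  exact Finsupp.single_injective _ key

theorem exists_sigma (h : IsQuasiCommSkewPBW ι x) (i : Fin n) (r : R) :
    ∃ c : R, x i * ι r = ι c * x i := by
  by_cases hr : r = 0
  · exact ⟨0, by simp [hr]⟩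
  · obtain ⟨c, -, hc⟩ := h.var_mul i r hr
    exact ⟨c, hc⟩

/-- The coefficient `c` in `x_i r = c x_i`. -/
def sigmaFun (h : IsQuasiCommSkewPBW ι x) (i : Fin n) (r : R) : R :=
  (h.exists_sigma i r).choose

theorem sigmaFun_spec (h : IsQuasiCommSkewPBW ι x) (i : Fin n) (r : R) :
    x i * ι r = ι (h.sigmaFun i r) * x i :=
  (h.exists_sigma i r).choose_spec

/-- The endomorphism `σ_i` of `R`, determined by `x_i r = σ_i(r) x_i`. -/
def sigma (h : IsQuasiCommSkewPBW ι x) (i : Fin n) : R →+* R where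
  toFun r := h.sigmaFun i r
  map_one' := h.cancel_var i (by rw [← h.sigmaFun_spec]; simp)
  map_zero' := h.cancel_var i (by rw [← h.sigmaFun_spec]; simp)
  map_mul' r s := h.cancel_var i (by
    rw [← h.sigmaFun_spec, map_mul, map_mul, ← mul_assoc, h.sigmaFun_spec i r, mul_assoc,
      h.sigmaFun_spec i s, mul_assoc])
  map_add' r s := h.cancel_var i (by
    rw [← h.sigmaFun_spec, map_add, map_add, mul_add, h.sigmaFun_spec i r,
      h.sigmaFun_spec i s, add_mul])

theorem var_mul_eq (h : IsQuasiCommSkewPBW ι x) (i : Fin n) (r : R) :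
    x i * ι r = ι (h.sigma i r) * x i :=
  h.sigmaFun_spec i r

/-- The parameter `c_{i,j}`, with `x_i x_j = c_{i,j} x_j x_i`. -/
def param (h : IsQuasiCommSkewPBW ι x) (i j : Fin n) : R :=
  (h.var_comm i j).choose

theorem param_spec (h : IsQuasiCommSkewPBW ι x) (i j : Fin n) :
    x i * x j = ι (h.param i j) * (x j * x i) :=
  (h.var_comm i j).choose_spec.2

/-- The subgroup `N` of `Rˣ` generated by the derived subgroup and all `z⁻¹ σ_i(z)`. -/
def paramSubgroup (h : IsQuasiCommSkewPBW ι x) : Subgroup Rˣ :=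
  commutator Rˣ ⊔
    Subgroup.closure {u | ∃ (i : Fin n) (z : Rˣ), u = z⁻¹ * Units.map (h.sigma i : R →* R) z}

instance paramSubgroup_normal (h : IsQuasiCommSkewPBW ι x) : h.paramSubgroup.Normal :=
  Subgroup.Normal.of_commutator_le _ le_sup_left

/-- The group `Rˣ / N` is commutative. -/
instance paramQuotientCommGroup (h : IsQuasiCommSkewPBW ι x) :
    CommGroup (Rˣ ⧸ h.paramSubgroup) :=
  { (inferInstance : Group (Rˣ ⧸ h.paramSubgroup)) with
    mul_comm := ((Subgroup.Normal.quotient_commutative_iff_commutator_le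
      (N := h.paramSubgroup)).2 le_sup_left).is_comm.comm }

/-- The extension is general: all `c_{i,j}` are invertible, and the images of the `c_{i,j}`
with `i < j` are (multiplicatively) independent in the abelian group `Rˣ / N`. -/
def IsGeneral (h : IsQuasiCommSkewPBW ι x) : Prop :=
  ∃ u : Fin n → Fin n → Rˣ, (∀ i j, (u i j : R) = h.param i j) ∧
    LinearIndependent ℤ (fun p : {p : Fin n × Fin n // p.1 < p.2} =>
      Additive.ofMul (QuotientGroup.mk (u p.1.1 p.1.2) : Rˣ ⧸ h.paramSubgroup))

/-- The multiplicative set `S = R ∖ {0}` of the domain `R`, viewed inside `A`. -/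
def denominators (_h : IsQuasiCommSkewPBW ι x) : Submonoid A :=
  R⁰.map ι

theorem stdMonomial_mul (h : IsQuasiCommSkewPBW ι x) (t : Fin n → ℕ) (r : R) (hr : r ≠ 0) :
    ∃ c : R, c ≠ 0 ∧ stdMonomial x t * ι r = ι c * stdMonomial x t := by
  let P : A → Prop := fun a => ∀ r : R, r ≠ 0 → ∃ c : R, c ≠ 0 ∧ a * ι r = ι c * a
  have hone : P 1 := fun r hr => ⟨r, hr, by simp⟩
  have hmul : ∀ a b, P a → P b → P (a * b) := by
    intro a b ha hb r hr
    obtain ⟨c, hc, e⟩ := hb r hr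
    obtain ⟨d, hd, e'⟩ := ha c hc
    exact ⟨d, hd, by rw [mul_assoc, e, ← mul_assoc, e', mul_assoc]⟩
  have hpow : ∀ i k, P (x i ^ k) := by
    intro i k
    induction k with
    | zero => simpa using hone
    | succ k ih => rw [pow_succ]; exact hmul _ _ ih (h.var_mul i)
  have hlist : ∀ l : List A, (∀ a ∈ l, P a) → P l.prod := by
    intro l
    induction l with
    | nil => intro _; simpa using hone
    | cons a l ih =>
      intro hl
      rw [List.prod_cons]
      exact hmul _ _ (hl a (by simp)) (ih fun b hb => hl b (by simp [hb]))
  refine hlist _ ?_ r hr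
  intro a ha
  obtain ⟨k, rfl⟩ := (List.mem_ofFn' _ _).1 ha
  exact hpow _ _

theorem eq_zero_of_mul_eq_zero [IsDomain R] (h : IsQuasiCommSkewPBW ι x) (a : A) (s : R)
    (hs : s ≠ 0) (e : a * ι s = 0) : a = 0 := by
  obtain ⟨f, rfl⟩ := h.basis.2 a
  choose c hc hcm using fun t => h.stdMonomial_mul t s hs
  let g : (Fin n → ℕ) →₀ R :=
    Finsupp.onFinset f.support (fun t => f t * c t)
      fun t ht => Finsupp.mem_support_iff.2 fun h0 => ht (by simp [h0])
  have hg : g = 0 := by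
    apply h.basis.1
    simp only [Finsupp.sum_zero_index]
    rw [← e, Finsupp.sum_of_support_subset g (s := f.support) Finsupp.support_onFinset_subset _
      (by simp)]
    simp only [Finsupp.sum, Finset.sum_mul]
    refine Finset.sum_congr rfl fun t _ => ?_
    rw [mul_assoc, hcm, ← mul_assoc, ← map_mul]
    rfl
  have hf : f = 0 := by
    ext t
    have : f t * c t = 0 := DFunLike.congr_fun hg t
    simpa [hc t] using this
  simp [hf]

theorem exists_ore [IsDomain R] [OreLocalization.OreSet R⁰] (h : IsQuasiCommSkewPBW ι x)
    (a : A) (s : R) (hs : s ≠ 0) : ∃ (s' : R⁰) (a' : A), ι s' * a = a' * ι s := by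
  obtain ⟨f, rfl⟩ := h.basis.2 a
  induction f using Finsupp.induction_linear with
  | zero => exact ⟨1, 0, by simp⟩
  | add f g hf hg =>
    obtain ⟨s₁, a₁, e₁⟩ := hf
    obtain ⟨s₂, a₂, e₂⟩ := hg
    have key := OreLocalization.ore_eq (s₁ : R) s₂
    refine ⟨OreLocalization.oreDenom (s₁ : R) s₂ * s₁,
      ι (OreLocalization.oreDenom (s₁ : R) s₂) * a₁ +
        ι (OreLocalization.oreNum (s₁ : R) s₂) * a₂, ?_⟩
    simp only at e₁ e₂ ⊢
    rw [Finsupp.sum_add_index' (by simp) (by simp [add_mul]), mul_add, add_mul]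
    congr 1
    · rw [Submonoid.coe_mul, map_mul, mul_assoc, e₁, mul_assoc]
    · rw [Submonoid.coe_mul, key, map_mul, mul_assoc, e₂, mul_assoc]
  | single t r =>
    obtain ⟨c, hc, e⟩ := h.stdMonomial_mul t s hs
    have key := OreLocalization.ore_eq r (⟨c, mem_nonZeroDivisors_of_ne_zero hc⟩ : R⁰)
    refine ⟨OreLocalization.oreDenom r (⟨c, mem_nonZeroDivisors_of_ne_zero hc⟩ : R⁰),
      ι (OreLocalization.oreNum r (⟨c, mem_nonZeroDivisors_of_ne_zero hc⟩ : R⁰)) *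
        stdMonomial x t, ?_⟩
    simp only
    rw [Finsupp.sum_single_index (by simp), ← mul_assoc, ← map_mul, key, map_mul, mul_assoc,
      mul_assoc, e]

theorem exists_ore' [IsDomain R] [OreLocalization.OreSet R⁰] (h : IsQuasiCommSkewPBW ι x)
    (a : A) (s : h.denominators) : ∃ (a' : A) (s' : h.denominators), (s' : A) * a = a' * s := by
  obtain ⟨_, r, hr, rfl⟩ := s
  obtain ⟨s', a', e⟩ := h.exists_ore a r (nonZeroDivisors.ne_zero hr)
  exact ⟨a', ⟨ι s', s', s'.2, rfl⟩, e⟩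

/-- If `R` is a left Ore domain, then `S = R ∖ {0}` is a left Ore set in `A`. -/
instance oreSet_denominators [IsDomain R] [OreLocalization.OreSet R⁰]
    (h : IsQuasiCommSkewPBW ι x) : OreLocalization.OreSet h.denominators where
  ore_right_cancel a b s e := ⟨1, by
    obtain ⟨_, r, hr, rfl⟩ := s
    have := h.eq_zero_of_mul_eq_zero (a - b) r (nonZeroDivisors.ne_zero hr)
      (by rw [sub_mul]; exact sub_eq_zero.2 e)
    rw [sub_eq_zero.1 this]⟩
  oreNum a s := (h.exists_ore' a s).choose
  oreDenom a s := (h.exists_ore' a s).choose_spec.choose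
  ore_eq a s := (h.exists_ore' a s).choose_spec.choose_spec

/-- The left Ore localization `S⁻¹A`, for `S = R ∖ {0}`. -/
abbrev Loc [IsDomain R] [OreLocalization.OreSet R⁰] (h : IsQuasiCommSkewPBW ι x) : Type _ :=
  OreLocalization h.denominators A

theorem isUnit_toLoc [IsDomain R] [OreLocalization.OreSet R⁰] (h : IsQuasiCommSkewPBW ι x)
    (s : R⁰) : IsUnit (((((OreLocalization.numeratorRingHom : A →+* h.Loc).comp ι) : R →* h.Loc).comp
      R⁰.subtype) s) :=
  OreLocalization.numerator_isUnit (⟨ι s, s, s.2, rfl⟩ : h.denominators)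

/-- The homomorphism `S⁻¹R → S⁻¹A` induced by `R ⊆ A`, where `S = R ∖ {0}`. -/
def locHom [IsDomain R] [OreLocalization.OreSet R⁰] (h : IsQuasiCommSkewPBW ι x) :
    OreLocalization R⁰ R →+* h.Loc :=
  OreLocalization.universalHom
    ((OreLocalization.numeratorRingHom : A →+* h.Loc).comp ι)
    (IsUnit.liftRight _ h.isUnit_toLoc)
    (fun _ => rfl)

/-- The image `x_i / 1` of the variable `x_i` in `S⁻¹A`. -/
def locVar [IsDomain R] [OreLocalization.OreSet R⁰] (h : IsQuasiCommSkewPBW ι x) (i : Fin n) :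
    h.Loc :=
  OreLocalization.numeratorRingHom (x i)

end IsQuasiCommSkewPBW

end

/-! Over `S⁻¹R` every nonzero coefficient is a unit, and modulo `N` units pass through monomials
unchanged. Write `f_i` for the image of `φ (x i)`; since `φ` fixes `R`, `f_i f_j = c_ij f_j f_i`. If
`s`, `t` are exponents of `f_i`, `f_j` whose sum `s + t` arises from no other pair, comparing the
coefficients there modulo `N` cancels everything but `∏ c_kl ^ (s_k t_l) = c_ij` (`prod_class_eq`).
As `c_lk = c_kl⁻¹`, independence turns this into `s ∧ t = e_i ∧ e_j` (`minors_of_prod_eq`), so `s`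
and `t` lie in the span of `e_i`, `e_j`. With a third nonzero image, `s` also lies in the span of
`e_i`, `e_k`, hence on the axis of `e_i`, and a determinant 1 of natural numbers forces `s = e_i`.
This applies to the lexicographically largest exponents and to the smallest ones alike, so `e_i` is
the only exponent of `f_i` (`support_subset_of_skewCommute`). -/

open scoped nonZeroDivisors

/-! ### Commutation up to units, with classes in an abelian quotient -/

section SkewCommutation

variable {K B Q : Type*} [Ring K] [Ring B] [CommGroup Q] (ι : K →+* B) (π : Kˣ →* Q)

/-- Units of `K` can be moved across `z` from right to left without changing their class. -/
def NormalizesUnits (z : B) : Prop :=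
  ∀ a : Kˣ, ∃ b : Kˣ, z * ι a = ι b * z ∧ π b = π a

/-- `z` and `w` commute up to a unit of `K` of class `q`. -/
def SkewCommute (z w : B) (q : Q) : Prop :=
  ∃ u : Kˣ, z * w = ι u * (w * z) ∧ π u = q

variable {ι π}

theorem NormalizesUnits.one : NormalizesUnits ι π 1 := fun a => ⟨a, by simp, rfl⟩

theorem NormalizesUnits.mul {z w : B} (hz : NormalizesUnits ι π z) (hw : NormalizesUnits ι π w) :
    NormalizesUnits ι π (z * w) := by
  intro a
  obtain ⟨b, hb, hb'⟩ := hw a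
  obtain ⟨c, hc, hc'⟩ := hz b
  exact ⟨c, by rw [mul_assoc, hb, ← mul_assoc, hc, mul_assoc], hc'.trans hb'⟩

theorem NormalizesUnits.pow {z : B} (hz : NormalizesUnits ι π z) (k : ℕ) :
    NormalizesUnits ι π (z ^ k) := by
  induction k with
  | zero => simpa using NormalizesUnits.one
  | succ k ih => rw [pow_succ]; exact ih.mul hz

theorem SkewCommute.one_left (w : B) : SkewCommute ι π 1 w 1 := ⟨1, by simp, by simp⟩

theorem SkewCommute.symm {z w : B} {q : Q} (h : SkewCommute ι π z w q) :
    SkewCommute ι π w z q⁻¹ := by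
  obtain ⟨u, hu, rfl⟩ := h
  exact ⟨u⁻¹, by rw [hu, ← mul_assoc, ← map_mul]; simp, by simp⟩

/-- The unit produced by `z'` and `w` must be moved left across `z`; this may change the unit but
not its class. -/
theorem SkewCommute.mul_left {z z' w : B} {q q' : Q} (hz : NormalizesUnits ι π z)
    (h : SkewCommute ι π z w q) (h' : SkewCommute ι π z' w q') :
    SkewCommute ι π (z * z') w (q * q') := by
  obtain ⟨u, hu, rfl⟩ := h
  obtain ⟨u', hu', rfl⟩ := h'
  obtain ⟨v, hv, hv'⟩ := hz u'
  refine ⟨v * u, ?_, by rw [map_mul, hv', mul_comm]⟩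
  rw [mul_assoc, hu', ← mul_assoc, hv, Units.val_mul, map_mul, mul_assoc, mul_assoc, ← mul_assoc z,
    hu, mul_assoc, mul_assoc]

theorem SkewCommute.pow_left {z w : B} {q : Q} (hz : NormalizesUnits ι π z)
    (h : SkewCommute ι π z w q) (k : ℕ) : SkewCommute ι π (z ^ k) w (q ^ k) := by
  induction k with
  | zero => simpa using SkewCommute.one_left w
  | succ k ih => rw [pow_succ, pow_succ]; exact .mul_left (hz.pow k) ih h

theorem NormalizesUnits.stdMonomial {n : ℕ} {x : Fin n → B}
    (hx : ∀ i, NormalizesUnits ι π (x i)) (t : Fin n → ℕ) :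
    NormalizesUnits ι π (stdMonomial x t) := by
  induction n with
  | zero => simpa [_root_.stdMonomial] using NormalizesUnits.one
  | succ n ih =>
    rw [_root_.stdMonomial, List.ofFn_succ, List.prod_cons]
    exact ((hx 0).pow _).mul (ih (fun i => hx i.succ) (fun i => t i.succ))

theorem SkewCommute.stdMonomial_left {n : ℕ} {x : Fin n → B} {w : B} {q : Fin n → Q}
    (hx : ∀ i, NormalizesUnits ι π (x i)) (h : ∀ i, SkewCommute ι π (x i) w (q i))
    (t : Fin n → ℕ) : SkewCommute ι π (stdMonomial x t) w (∏ i, q i ^ t i) := by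
  induction n with
  | zero => simpa [stdMonomial] using SkewCommute.one_left w
  | succ n ih =>
    rw [stdMonomial, List.ofFn_succ, List.prod_cons, Fin.prod_univ_succ]
    exact .mul_left ((hx 0).pow _) (.pow_left (hx 0) (h 0) _)
      (ih (fun i => hx i.succ) (fun i => h i.succ) (fun i => t i.succ))

theorem SkewCommute.stdMonomial {n : ℕ} {x : Fin n → B} {q : Fin n → Fin n → Q}
    (hx : ∀ i, NormalizesUnits ι π (x i)) (h : ∀ i j, SkewCommute ι π (x i) (x j) (q i j))
    (s t : Fin n → ℕ) :
    SkewCommute ι π (stdMonomial x s) (stdMonomial x t) (∏ i, ∏ j, q i j ^ (s i * t j)) := by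
  -- The one-sided lemma is used in each argument; the inverses introduced by `symm` cancel below.
  have key := SkewCommute.stdMonomial_left hx
    (fun i => (SkewCommute.stdMonomial_left hx (fun j => (h i j).symm) t).symm) s
  convert key using 1
  refine Finset.prod_congr rfl fun i _ => ?_
  rw [← Finset.prod_inv_distrib, ← Finset.prod_pow]
  refine Finset.prod_congr rfl fun j _ => ?_
  rw [← inv_pow, inv_inv, ← pow_mul, mul_comm]

/-- The class of the unit is not recorded, because it cancels when the two orders of a product are
compared. -/
theorem exists_stdMonomial_mul_stdMonomial {n : ℕ} {x : Fin n → B} {q : Fin n → Fin n → Q}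
    (hx : ∀ i, NormalizesUnits ι π (x i)) (h : ∀ i j, SkewCommute ι π (x i) (x j) (q i j))
    (s t : Fin n → ℕ) :
    ∃ v : Kˣ, stdMonomial x s * stdMonomial x t = ι v * stdMonomial x (s + t) := by
  induction n with
  | zero => exact ⟨1, by simp [_root_.stdMonomial]⟩
  | succ n ih =>
    obtain ⟨v, hv⟩ := ih (fun i => hx i.succ) (fun i j => h i.succ j.succ)
      (fun i => s i.succ) (fun i => t i.succ)
    obtain ⟨u, hu, -⟩ := (SkewCommute.pow_left (hx 0) (SkewCommute.stdMonomial_left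
      (fun i => hx i.succ) (fun i => h i.succ 0) (fun i => s i.succ)).symm (t 0)).symm
    obtain ⟨w, hw, -⟩ := (hx 0).pow (s 0) u
    obtain ⟨w', hw', -⟩ := (hx 0).pow (s 0 + t 0) v
    refine ⟨w * w', ?_⟩
    have split : ∀ r : Fin (n + 1) → ℕ, stdMonomial x r =
        x 0 ^ r 0 * stdMonomial (fun i => x i.succ) (fun i => r i.succ) := fun r => by
      rw [stdMonomial, List.ofFn_succ, List.prod_cons, stdMonomial]
    simp only [split]
    generalize stdMonomial (fun i => x i.succ) (fun i => s i.succ) = P at *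
    generalize stdMonomial (fun i => x i.succ) (fun i => t i.succ) = P' at *
    calc x 0 ^ s 0 * P * (x 0 ^ t 0 * P') = x 0 ^ s 0 * (P * x 0 ^ t 0) * P' := by noncomm_ring
      _ = (x 0 ^ s 0 * ι u) * x 0 ^ t 0 * (P * P') := by rw [hu]; noncomm_ring
      _ = ι w * (x 0 ^ (s 0 + t 0) * ι v) *
            stdMonomial (fun i => x i.succ) ((fun i => s i.succ) + fun i => t i.succ) := by
          rw [hw, hv, pow_add]; noncomm_ring
      _ = _ := by rw [hw', Units.val_mul, map_mul]; simp only [mul_assoc]; rfl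

end SkewCommutation

/-! ### Coefficients at isolated exponents -/

namespace IsQuasiCommSkewPBW

section Coefficients

variable {K B : Type*} [Ring K] [Ring B] {n : ℕ} {ι : K →+* B} {x : Fin n → B}

/-- The coefficient of `x^t` in an element of a quasi-commutative skew PBW extension. -/
noncomputable def coeff (h : IsQuasiCommSkewPBW ι x) (t : Fin n → ℕ) : B →+ K where
  toFun b := (Equiv.ofBijective _ h.basis).symm b t
  map_zero' := by
    have : (Equiv.ofBijective _ h.basis).symm 0 = 0 := (Equiv.symm_apply_eq _).2 (by simp)
    rw [this, Finsupp.zero_apply]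
  map_add' a b := by
    have : (Equiv.ofBijective _ h.basis).symm (a + b) = (Equiv.ofBijective _ h.basis).symm a +
        (Equiv.ofBijective _ h.basis).symm b := by
      rw [Equiv.symm_apply_eq, Equiv.ofBijective_apply,
        Finsupp.sum_add_index' (by simp) (by simp [add_mul])]
      exact congrArg₂ _ ((Equiv.ofBijective _ h.basis).apply_symm_apply a).symm
        ((Equiv.ofBijective _ h.basis).apply_symm_apply b).symm
    rw [this, Finsupp.add_apply]

theorem coeff_mul_stdMonomial (h : IsQuasiCommSkewPBW ι x) (s t : Fin n → ℕ) (a : K) :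
    h.coeff t (ι a * stdMonomial x s) = Finsupp.single s a t := by
  have : (Equiv.ofBijective _ h.basis).symm (ι a * stdMonomial x s) = Finsupp.single s a := by
    rw [Equiv.symm_apply_eq, Equiv.ofBijective_apply, Finsupp.sum_single_index (by simp)]
  exact DFunLike.congr_fun this t

theorem coeff_smul (h : IsQuasiCommSkewPBW ι x) (t : Fin n → ℕ) (c : K) (b : B) :
    h.coeff t (ι c * b) = c * h.coeff t b := by
  obtain ⟨f, rfl⟩ := h.basis.2 b
  simp only [Finsupp.sum, Finset.mul_sum, map_sum, ← mul_assoc, ← map_mul, coeff_mul_stdMonomial]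
  refine Finset.sum_congr rfl fun s _ => ?_
  by_cases e : s = t
  · simp [e]
  · simp [Finsupp.single_eq_of_ne' e]

/-- If only one pair of terms contributes to the exponent `s + t`, the coefficient of a product
at this exponent is that of the product of these two terms. -/
theorem coeff_sum_mul_sum (h : IsQuasiCommSkewPBW ι x)
    (hmul : ∀ s t, ∃ v : K, stdMonomial x s * stdMonomial x t = ι v * stdMonomial x (s + t))
    {F G : Finset (Fin n → ℕ)} (a b : (Fin n → ℕ) → K) {s t : Fin n → ℕ}
    (hs : s ∈ F) (ht : t ∈ G) (hu : UniqueAdd F G s t) :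
    h.coeff (s + t) ((∑ p ∈ F, ι (a p) * stdMonomial x p) * ∑ p ∈ G, ι (b p) * stdMonomial x p) =
      h.coeff (s + t) ((ι (a s) * stdMonomial x s) * (ι (b t) * stdMonomial x t)) := by
  have hterm : ∀ p r, p + r ≠ s + t →
      h.coeff (s + t) ((ι (a p) * stdMonomial x p) * (ι (b r) * stdMonomial x r)) = 0 := by
    intro p r hne
    obtain ⟨c, hc⟩ : ∃ c, stdMonomial x p * ι (b r) = ι c * stdMonomial x p := by
      by_cases e : b r = 0
      · exact ⟨0, by simp [e]⟩
      · obtain ⟨c, -, hc⟩ := h.stdMonomial_mul p (b r) e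
        exact ⟨c, hc⟩
    obtain ⟨v, hv⟩ := hmul p r
    have : (ι (a p) * stdMonomial x p) * (ι (b r) * stdMonomial x r) =
        ι (a p * c * v) * stdMonomial x (p + r) := by
      rw [mul_assoc, ← mul_assoc (stdMonomial x p), hc, mul_assoc (ι c), hv, map_mul, map_mul]
      simp only [mul_assoc]
    rw [this, coeff_mul_stdMonomial, Finsupp.single_eq_of_ne' hne]
  rw [Finset.sum_mul_sum, map_sum, Finset.sum_eq_single_of_mem s hs, map_sum,
    Finset.sum_eq_single_of_mem t ht]
  · exact fun r hr hne => hterm _ _ fun e => hne (hu hs hr e).2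
  · intro p hp hne
    rw [map_sum]
    exact Finset.sum_eq_zero fun r hr => hterm _ _ fun e => hne (hu hp hr e).1

variable {Q : Type*} [CommGroup Q] {π : Kˣ →* Q} {q : Fin n → Fin n → Q}

/-- If two elements skew-commute, the class of the factor is determined by the exponents of any
two of their terms whose product is isolated. -/
theorem prod_class_eq (h : IsQuasiCommSkewPBW ι x)
    (hx : ∀ i, NormalizesUnits ι π (x i)) (hq : ∀ i j, SkewCommute ι π (x i) (x j) (q i j))
    {F G : Finset (Fin n → ℕ)} (a b : (Fin n → ℕ) → K) {s t : Fin n → ℕ}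
    (hs : s ∈ F) (ht : t ∈ G) (hu : UniqueAdd F G s t) (ha : IsUnit (a s)) (hb : IsUnit (b t))
    {r : Q} (hc : SkewCommute ι π (∑ p ∈ F, ι (a p) * stdMonomial x p)
      (∑ p ∈ G, ι (b p) * stdMonomial x p) r) :
    ∏ i, ∏ j, q i j ^ (s i * t j) = r := by
  have hmul s t : ∃ v : K, stdMonomial x s * stdMonomial x t = ι v * stdMonomial x (s + t) :=
    (exists_stdMonomial_mul_stdMonomial hx hq s t).imp' _ fun v hv => hv
  obtain ⟨c, hc, rfl⟩ := hc
  replace hc := congrArg (h.coeff (s + t)) hc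
  have hu' : UniqueAdd G F t s := fun p r hp hr e =>
    (hu hr hp (by rw [add_comm, e, add_comm])).symm
  have key := coeff_sum_mul_sum h hmul b a ht hs hu'
  rw [add_comm t s] at key
  rw [coeff_smul, coeff_sum_mul_sum h hmul a b hs ht hu, key] at hc
  obtain ⟨a', ha⟩ := ha
  obtain ⟨b', hb⟩ := hb
  rw [← ha, ← hb] at hc
  obtain ⟨b₁, hb₁, hb₁'⟩ := NormalizesUnits.stdMonomial hx s b'
  obtain ⟨a₁, ha₁, ha₁'⟩ := NormalizesUnits.stdMonomial hx t a'
  obtain ⟨u, hu₁, hu₂⟩ := SkewCommute.stdMonomial hx hq s t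
  obtain ⟨v, hv⟩ := exists_stdMonomial_mul_stdMonomial hx hq t s
  have e₁ : (ι a' * stdMonomial x s) * (ι b' * stdMonomial x t) =
      ι (a' * b₁ * u * v : Kˣ) * stdMonomial x (s + t) := by
    rw [mul_assoc, ← mul_assoc (stdMonomial x s), hb₁, mul_assoc (ι b₁), hu₁, hv, add_comm t s]
    simp only [Units.val_mul, map_mul, mul_assoc]
  have e₂ : (ι b' * stdMonomial x t) * (ι a' * stdMonomial x s) =
      ι (b' * a₁ * v : Kˣ) * stdMonomial x (s + t) := by
    rw [mul_assoc, ← mul_assoc (stdMonomial x t), ha₁, mul_assoc (ι a₁), hv, add_comm t s]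
    simp only [Units.val_mul, map_mul, mul_assoc]
  rw [e₁, e₂, coeff_mul_stdMonomial, coeff_mul_stdMonomial, Finsupp.single_eq_same,
    Finsupp.single_eq_same, ← Units.val_mul, Units.val_inj] at hc
  replace hc := congrArg π hc
  simp only [map_mul, hb₁', ha₁', hu₂] at hc
  generalize ∏ i, ∏ j, q i j ^ (s i * t j) = d at *
  -- Both orders of the product contribute the classes of the two coefficients and of `v`; only `d`
  -- and `π c` differ.
  refine mul_left_cancel (a := π a' * π b' * π v) ?_
  calc _ = π a' * π b' * d * π v := by ac_rfl
    _ = _ := by rw [hc, mul_comm (π b'), mul_comm (π c)]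

end Coefficients

end IsQuasiCommSkewPBW

/-! ### From multiplicative relations to minors of exponents -/

theorem prod_prod_eq_prod_lt {M : Type*} [CommMonoid M] {n : ℕ} (f : Fin n → Fin n → M)
    (hf : ∀ i, f i i = 1) :
    ∏ i, ∏ j, f i j =
      ∏ p : {p : Fin n × Fin n // p.1 < p.2}, f p.1.1 p.1.2 * f p.1.2 p.1.1 := by
  have h₁ : ∀ p : Fin n × Fin n, f p.1 p.2 =
      (if p.1 < p.2 then f p.1 p.2 else 1) * (if p.2 < p.1 then f p.1 p.2 else 1) := by
    rintro ⟨i, j⟩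
    rcases lt_trichotomy i j with h | rfl | h
    · simp [h, h.not_gt]
    · simp [hf]
    · simp [h, h.not_gt]
  rw [← Fintype.prod_prod_type', Finset.prod_congr rfl fun p _ => h₁ p, Finset.prod_mul_distrib,
    ← (Equiv.prodComm (Fin n) (Fin n)).prod_comp (fun p => if p.2 < p.1 then f p.1 p.2 else 1),
    ← Finset.prod_mul_distrib, ← Finset.prod_subtype (Finset.univ.filter fun p => p.1 < p.2)
      (by simp) (fun p : Fin n × Fin n => f p.1 p.2 * f p.2 p.1), Finset.prod_filter]
  refine Finset.prod_congr rfl fun p _ => ?_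
  by_cases h : p.1 < p.2 <;> simp [h]

/-- Pairing `(k, l)` with `(l, k)` gives `q k l` the exponent `s_k t_l - s_l t_k`; independence then
allows exponents to be compared. -/
theorem minors_of_prod_eq {Q : Type*} [CommGroup Q] {n : ℕ} {q : Fin n → Fin n → Q}
    (hdiag : ∀ i, q i i = 1) (hinv : ∀ i j, q j i = (q i j)⁻¹)
    (hind : LinearIndependent ℤ (fun p : {p : Fin n × Fin n // p.1 < p.2} =>
      Additive.ofMul (q p.1.1 p.1.2)))
    {s t : Fin n → ℕ} {i j : Fin n} (hij : i < j)
    (h : ∏ k, ∏ l, q k l ^ (s k * t l) = q i j) :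
    ∀ k l, k < l → (s k * t l - s l * t k : ℤ) = if k = i ∧ l = j then 1 else 0 := by
  intro k l hkl
  rw [prod_prod_eq_prod_lt _ (by simp [hdiag])] at h
  have key := Fintype.linearIndependent_iff.1 hind
    (fun p => (s p.1.1 * t p.1.2 - s p.1.2 * t p.1.1 : ℤ) -
      if p = ⟨(i, j), hij⟩ then 1 else 0) ?_ ⟨(k, l), hkl⟩
  · simpa [sub_eq_zero] using key
  · simp only [sub_smul, Finset.sum_sub_distrib]
    rw [sub_eq_zero]
    simp only [ite_smul, one_smul, zero_smul, Finset.sum_ite_eq', Finset.mem_univ, if_true]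
    rw [← h]
    rw [← Finset.sum_sub_distrib]
    refine Eq.trans (Finset.sum_congr rfl fun p _ => ?_) (ofMul_prod _ _).symm
    rw [hinv p.1.1 p.1.2, ofMul_mul, ofMul_pow, ofMul_pow, ofMul_inv, ← natCast_zsmul,
      ← natCast_zsmul]
    push_cast
    module

/-- Two exponents whose exterior product is that of two coordinate vectors lie in the span of
these vectors. -/
theorem eq_zero_of_minors {n : ℕ} {s t : Fin n → ℕ} {i j : Fin n} (hij : i < j)
    (h : ∀ k l, k < l → (s k * t l - s l * t k : ℤ) = if k = i ∧ l = j then 1 else 0) :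
    (∀ k, k ≠ i → k ≠ j → s k = 0 ∧ t k = 0) ∧ (s i * t j - s j * t i : ℤ) = 1 := by
  have h1 : (s i * t j - s j * t i : ℤ) = 1 := by simpa using h i j hij
  refine ⟨fun k hki hkj => ?_, h1⟩
  have hz : ∀ l, l ≠ k → (s k * t l - s l * t k : ℤ) = 0 := by
    intro l hl
    rcases lt_or_gt_of_ne hl with hlt | hlt
    · have := h l k hlt
      rw [if_neg (by tauto)] at this
      linarith
    · simpa [hki] using h k l hlt
  have hi := hz i hki.symm
  have hj := hz j hkj.symm
  -- A 3 × 3 determinant with a repeated row vanishes; its expansion writes `s k` times the `(i, j)`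
  -- minor through the two zero minors.
  have hs : (s k : ℤ) = 0 := by linear_combination (-(s k : ℤ)) * h1 + s i * hj - s j * hi
  have ht : (t k : ℤ) = 0 := by linear_combination (-(t k : ℤ)) * h1 + t i * hj - t j * hi
  exact ⟨by exact_mod_cast hs, by exact_mod_cast ht⟩

/-- In an ordered cancellative monoid a sum of two maxima is attained only by these maxima. -/
theorem uniqueAdd_of_forall_le {M : Type*} [AddCommMonoid M] {L : Type*} [AddCommMonoid L]
    [PartialOrder L] [IsOrderedCancelAddMonoid L] (e : M ≃+ L) {F G : Finset M} {s t : M}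
    (hs : ∀ p ∈ F, e p ≤ e s) (ht : ∀ p ∈ G, e p ≤ e t) : UniqueAdd F G s t := by
  intro p r hp hr h
  have := (add_eq_add_iff_eq_and_eq (hs p hp) (ht r hr)).1 (by rw [← map_add, h, map_add])
  exact ⟨e.injective this.1, e.injective this.2⟩

theorem uniqueAdd_of_forall_ge {M : Type*} [AddCommMonoid M] {L : Type*} [AddCommMonoid L]
    [PartialOrder L] [IsOrderedCancelAddMonoid L] (e : M ≃+ L) {F G : Finset M} {s t : M}
    (hs : ∀ p ∈ F, e s ≤ e p) (ht : ∀ p ∈ G, e t ≤ e p) : UniqueAdd F G s t := by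
  intro p r hp hr h
  have := (add_eq_add_iff_eq_and_eq (hs p hp) (ht r hr)).1 (by rw [← map_add, ← h, map_add])
  exact ⟨e.injective this.1.symm, e.injective this.2.symm⟩

/-- If the three pairwise exterior products of three exponents are those of three coordinate
vectors, then the exponents are these vectors. -/
theorem eq_single_of_minors {n : ℕ} {s t u : Fin n → ℕ} {i j k : Fin n}
    (hjk : j ≠ k) (hij : i ≠ j)
    (hst : (∀ m, m ≠ i → m ≠ j → s m = 0 ∧ t m = 0) ∧ (s i * t j - s j * t i : ℤ) = 1)
    (hsu : ∀ m, m ≠ i → m ≠ k → s m = 0 ∧ u m = 0) :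
    s = Pi.single i 1 := by
  have hs : ∀ m, m ≠ i → s m = 0 := by
    intro m hm
    by_cases hmj : m = j
    · subst hmj
      exact (hsu m hm hjk).1
    · exact (hst.1 m hm hmj).1
  have h1 := hst.2
  rw [hs j hij.symm] at h1
  have : s i * t j = 1 := by
    have : (s i * t j : ℤ) = 1 := by simpa using h1
    exact_mod_cast this
  funext m
  by_cases hm : m = i
  · subst hm
    simpa using Nat.eq_one_of_mul_eq_one_right this
  · simp [hs m hm, hm]

/-! ### Supports in a general extension -/

namespace IsQuasiCommSkewPBW

variable {K B : Type*} [Ring K] [Ring B] {n : ℕ} {ι : K →+* B} {x : Fin n → B}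

/-- Makes the parameters, which are obtained by choice, unique. -/
theorem eq_of_smul_var_mul_var {Q : Type*} [CommGroup Q] {π : Kˣ →* Q} {q : Fin n → Fin n → Q}
    (h : IsQuasiCommSkewPBW ι x)
    (hx : ∀ i, NormalizesUnits ι π (x i)) (hq : ∀ i j, SkewCommute ι π (x i) (x j) (q i j))
    {a b : K} {i j : Fin n} (e : ι a * (x i * x j) = ι b * (x i * x j)) : a = b := by
  obtain ⟨v, hv⟩ := exists_stdMonomial_mul_stdMonomial hx hq (Pi.single i 1) (Pi.single j 1)
  rw [stdMonomial_single, stdMonomial_single] at hv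
  rw [hv, ← mul_assoc, ← mul_assoc, ← map_mul, ← map_mul] at e
  have := congrArg (h.coeff (Pi.single i 1 + Pi.single j 1)) e
  rw [coeff_mul_stdMonomial, coeff_mul_stdMonomial, Finsupp.single_eq_same,
    Finsupp.single_eq_same] at this
  exact v.isUnit.mul_right_cancel this

/-- This is why `N` contains every `z⁻¹ σ_i(z)`. -/
theorem normalizesUnits_var (h : IsQuasiCommSkewPBW ι x) (i : Fin n) :
    NormalizesUnits ι (QuotientGroup.mk' h.paramSubgroup) (x i) := by
  intro a
  refine ⟨Units.map (h.sigma i : K →* K) a, h.var_mul_eq i a, ?_⟩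
  refine (QuotientGroup.eq.2 ?_).symm
  exact le_sup_right (a := commutator Kˣ) (Subgroup.subset_closure ⟨i, a, rfl⟩)

/-- In a general extension, an element other than zero that skew-commutes with two others like
the corresponding three variables has no monomial but its variable. -/
theorem support_subset_of_skewCommute (h : IsQuasiCommSkewPBW ι x) {u : Fin n → Fin n → Kˣ}
    (hu : ∀ i j, (u i j : K) = h.param i j)
    (hind : LinearIndependent ℤ (fun p : {p : Fin n × Fin n // p.1 < p.2} =>
      Additive.ofMul (QuotientGroup.mk (u p.1.1 p.1.2) : Kˣ ⧸ h.paramSubgroup)))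
    (F : Fin n → Finset (Fin n → ℕ)) (a : Fin n → (Fin n → ℕ) → K)
    (ha : ∀ i, ∀ s ∈ F i, IsUnit (a i s))
    (hcomm : ∀ i j, (∑ p ∈ F i, ι (a i p) * stdMonomial x p) *
        (∑ p ∈ F j, ι (a j p) * stdMonomial x p) = ι (h.param i j) *
      ((∑ p ∈ F j, ι (a j p) * stdMonomial x p) * (∑ p ∈ F i, ι (a i p) * stdMonomial x p)))
    {i j k : Fin n} (hij : i ≠ j) (hik : i ≠ k) (hjk : j ≠ k)
    (hi : (F i).Nonempty) (hj : (F j).Nonempty) (hk : (F k).Nonempty) :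
    F i ⊆ {Pi.single i 1} := by
  set π := QuotientGroup.mk' h.paramSubgroup
  have hx := h.normalizesUnits_var
  have hq : ∀ i j, SkewCommute ι π (x i) (x j) (π (u i j)) := fun i j =>
    ⟨u i j, by rw [hu, h.param_spec], rfl⟩
  have hdiag : ∀ i, π (u i i) = 1 := fun i => by
    have : u i i = 1 := Units.ext (h.eq_of_smul_var_mul_var hx hq (i := i) (j := i)
      (by rw [hu, ← h.param_spec]; simp))
    rw [this, map_one]
  have hinv : ∀ i j, π (u j i) = (π (u i j))⁻¹ := fun i j => by
    rw [eq_inv_iff_mul_eq_one, ← map_mul]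
    have : u j i * u i j = 1 := Units.ext (h.eq_of_smul_var_mul_var hx hq (i := j) (j := i) (by
      rw [Units.val_mul, map_mul, mul_assoc, hu, hu, ← h.param_spec, ← h.param_spec]; simp))
    rw [this, map_one]
  have hminor : ∀ {i j : Fin n}, i ≠ j → ∀ {s t}, s ∈ F i → t ∈ F j → UniqueAdd (F i) (F j) s t →
      (∀ m, m ≠ i → m ≠ j → s m = 0 ∧ t m = 0) ∧ (s i * t j - s j * t i : ℤ) = 1 := by
    intro i j hij s t hs ht hst
    rcases lt_or_gt_of_ne hij with hlt | hlt
    · exact eq_zero_of_minors hlt (minors_of_prod_eq hdiag hinv hind hlt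
        (h.prod_class_eq hx hq (a i) (a j) hs ht hst (ha i s hs) (ha j t ht)
          ⟨u i j, by rw [hu, hcomm], rfl⟩))
    · have hts : UniqueAdd (F j) (F i) t s := fun p r hp hr e =>
        (hst hr hp (by rw [add_comm, e, add_comm])).symm
      have := eq_zero_of_minors hlt (minors_of_prod_eq hdiag hinv hind hlt
        (h.prod_class_eq hx hq (a j) (a i) ht hs hts (ha j t ht) (ha i s hs)
          ⟨u j i, by rw [hu, hcomm], rfl⟩))
      exact ⟨fun m hmi hmj => (this.1 m hmj hmi).symm, by linarith [this.2]⟩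
  -- The lexicographic order is total and compatible with addition, so extreme exponents have
  -- isolated sums.
  let e : (Fin n → ℕ) ≃+ Lex (Fin n → ℕ) := toLexAddEquiv _
  obtain ⟨s, hs, hs'⟩ := (F i).exists_max_image e hi
  obtain ⟨t, ht, ht'⟩ := (F j).exists_max_image e hj
  obtain ⟨r, hr, hr'⟩ := (F k).exists_max_image e hk
  have hmax := eq_single_of_minors hjk hij
    (hminor hij hs ht (uniqueAdd_of_forall_le e hs' ht'))
    (hminor hik hs hr (uniqueAdd_of_forall_le e hs' hr')).1
  obtain ⟨s₀, hs₀, hs₀'⟩ := (F i).exists_min_image e hi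
  obtain ⟨t₀, ht₀, ht₀'⟩ := (F j).exists_min_image e hj
  obtain ⟨r₀, hr₀, hr₀'⟩ := (F k).exists_min_image e hk
  have hmin := eq_single_of_minors hjk hij
    (hminor hij hs₀ ht₀ (uniqueAdd_of_forall_ge e hs₀' ht₀'))
    (hminor hik hs₀ hr₀ (uniqueAdd_of_forall_ge e hs₀' hr₀')).1
  intro p hp
  rw [Finset.mem_singleton]
  exact e.injective (le_antisymm (hmax ▸ hs' p hp) (hmin ▸ hs₀' p hp))

/-! ### Passage to the localization and the theorem -/

variable {R A : Type*} [Ring R] [IsDomain R] [OreLocalization.OreSet R⁰] [Ring A]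
  {ι : R →+* A} {x : Fin n → A}

theorem locHom_numerator (h : IsQuasiCommSkewPBW ι x) (r : R) :
    h.locHom (OreLocalization.numeratorRingHom r) = OreLocalization.numeratorRingHom (ι r) :=
  OreLocalization.universalHom_commutes _ _ _

theorem numerator_stdMonomial (h : IsQuasiCommSkewPBW ι x) (t : Fin n → ℕ) :
    (OreLocalization.numeratorRingHom (stdMonomial x t) : h.Loc) = stdMonomial h.locVar t := by
  rw [stdMonomial, map_list_prod, List.map_ofFn, stdMonomial]
  exact congrArg (fun g => (List.ofFn g).prod) (funext fun i =>
    map_pow (OreLocalization.numeratorRingHom : A →+* h.Loc) (x i) (t i))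

end IsQuasiCommSkewPBW

theorem mainTheorem5 {R A : Type*} [Ring R] [IsDomain R] [OreLocalization.OreSet R⁰] [Ring A]
    {n : ℕ} (ι : R →+* A) (x : Fin n → A) (hA : IsQuasiCommSkewPBW ι x)
    (hgen : ∃ hS : IsQuasiCommSkewPBW hA.locHom hA.locVar, hS.IsGeneral)
    (φ : A →+* A) (hφ : ∀ r : R, φ (ι r) = ι r)
    (hnz : ∃ i j t : Fin n, i ≠ j ∧ i ≠ t ∧ j ≠ t ∧ φ (x i) ≠ 0 ∧ φ (x j) ≠ 0 ∧ φ (x t) ≠ 0) :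
    ∃ l : Fin n → R, ∀ w : Fin n, φ (x w) = ι (l w) * x w := by
  obtain ⟨hS, u, hu, hind⟩ := hgen
  let θ : A →+* hA.Loc := OreLocalization.numeratorRingHom
  let κ : R →+* OreLocalization R⁰ R := OreLocalization.numeratorRingHom
  have hθ : ∀ r, θ (ι r) = hA.locHom (κ r) := fun r => (hA.locHom_numerator r).symm
  -- The expansion is taken in `A`, so the final coefficients lie in `R`; the localization only
  -- constrains the support.
  choose f hf using fun w => hA.basis.2 (φ (x w))
  simp only at hf
  have hθf : ∀ w, θ (φ (x w)) =
      ∑ p ∈ (f w).support, hA.locHom (κ (f w p)) * stdMonomial hA.locVar p := by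
    intro w
    rw [← hf w, Finsupp.sum, map_sum]
    refine Finset.sum_congr rfl fun p _ => ?_
    rw [map_mul, hθ]
    exact congrArg _ (hA.numerator_stdMonomial p)
  have hparam : ∀ i j, κ (hA.param i j) = hS.param i j := by
    intro i j
    refine hS.eq_of_smul_var_mul_var hS.normalizesUnits_var
      (fun i j => ⟨u i j, by rw [hu, hS.param_spec], rfl⟩) (i := j) (j := i) ?_
    rw [← hS.param_spec, ← hθ]
    have := congrArg θ (hA.param_spec i j)
    rw [map_mul, map_mul, map_mul] at this
    exact this.symm
  have hne : ∀ w, φ (x w) ≠ 0 → (f w).support.Nonempty := by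
    intro w hw
    rw [Finsupp.support_nonempty_iff]
    intro h0
    exact hw (by rw [← hf w, h0, Finsupp.sum_zero_index])
  have key : ∀ {i j k : Fin n}, i ≠ j → i ≠ k → j ≠ k → φ (x i) ≠ 0 → φ (x j) ≠ 0 →
      φ (x k) ≠ 0 → (f i).support ⊆ {Pi.single i 1} := by
    intro i j k hij hik hjk hi hj hk
    refine hS.support_subset_of_skewCommute hu hind (fun w => (f w).support)
      (fun w p => κ (f w p)) (fun w p hp => ?_) (fun w w' => ?_) hij hik hjk
      (hne i hi) (hne j hj) (hne k hk)
    · exact OreLocalization.numerator_isUnit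
        (⟨f w p, mem_nonZeroDivisors_of_ne_zero (Finsupp.mem_support_iff.1 hp)⟩ : R⁰)
    · simp only [← hθf]
      rw [← hparam, ← hθ, ← map_mul, ← map_mul, ← map_mul, ← map_mul, hA.param_spec, map_mul,
        hφ, map_mul φ (x w'), map_mul]
  refine ⟨fun w => f w (Pi.single w 1), fun w => ?_⟩
  obtain ⟨i, j, t, hij, hit, hjt, hi, hj, ht⟩ := hnz
  have hw : (f w).support ⊆ {Pi.single w 1} := by
    by_cases h0 : φ (x w) = 0
    · have : f w = 0 := hA.basis.1 (by simp only [hf w, h0, Finsupp.sum_zero_index])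
      simp [this]
    -- Whatever `w` is, two of the three given indices differ from it and serve as its companions.
    by_cases hwi : w = i
    · subst hwi; exact key hij hit hjt h0 hj ht
    by_cases hwj : w = j
    · subst hwj; exact key hwi hjt hit h0 hi ht
    exact key hwi hwj hij h0 hi hj
  conv_lhs => rw [← hf w]
  rw [Finsupp.sum_of_support_subset _ hw _ (by simp), Finset.sum_singleton,
    IsQuasiCommSkewPBW.stdMonomial_single]
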